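/- Let $e(w)=e^{2\pi i w}$, and let $\Gamma^J=SL(2,\mathbb Z)\ltimes\mathbb Z^2$ be the Jacobi group, with group law $(M,X)(M',X')=(MM',XM'+X')$. For integers $k$ and $m\ge 1$ it acts on functions $\phi:\mathcal H\times\mathbb C\to\mathbb C$ by \[ (\phi|_{k,m}\gamma)(\tau,z)=(c\tau+d)^{-k}\,e\!\left(-\frac{c\,m(z+\lambda\tau+\mu)^2}{c\tau+d}+m\lambda^2\tau+2m\lambda z\right)\phi\!\left(\frac{a\tau+b}{c\tau+d},\frac{z+\lambda\tau+\mu}{c\tau+d}\right),\quad \gamma=\left(\begin{pmatrix}a&b\\c&d\end{pmatrix},(\lambda,\mu)\right). \] Let $\Gamma^J_\infty=\left\{\left(\begin{pmatrix}1&b\\0&1\end{pmatrix},(0,\mu)\right): b,\mu\in\mathbb Z\right\}$. Let $k>3$ and $m\geq 1$ be integers, let $n\ge 0$ and $r$ be integers, and put $D=\det\begin{pmatrix}2n&r\\r&2m\end{pmatrix}=4mn-r^2$. The Jacobi Poincaré series is \[ P^{k,m}_{D,r}(\tau,z)=\sum_{\gamma\in\Gamma^J_\infty\backslash\Gamma^J}\bigl(e(n\tau+rz)\bigr)\big|_{k,m}\gamma\,(\tau,z).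 \] Suppose that $k$ is even if $2r\equiv 0\pmod{2m}$. Let $B_1>\log 2$, let \[ M(x)=\exp\left(\frac{B_1\log x}{\log\log 2x}\right)\qquad(x>1) \] (with the exponent read as $0$ at the single point $x=e/2$, where $\log\log 2x=0$), let $\sigma_0(D)=\sum_{d\mid D}1$, and let \[ A=\frac1\pi\left(\frac{2}{6^{2/3}}+\frac{54}{2^{5/6}}+\frac{16}{2^{3/4}}\right),\qquad \lambda=\left(2\sqrt2\,\pi^{5/3}A\right)^{3/2}. \] If $D>\dfrac m\pi$ and \[ M\!\left(\frac{\pi D}{m}\right)\sigma_0(D)\,D<\frac{m^{8/7}}{\lambda}, \] then $P^{k,m}_{D,r}$ is not identically zero. -/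

import Mathlib

open scoped MatrixGroups

namespace JacobiPoincare

noncomputable section

/-- The Jacobi group `SL(2, ℤ) ⋉ (ℤ × ℤ)` of degree one; an element is `(M, (lam, mu))`. -/
@[ext]
structure JacobiGroup where
  /-- the matrix part -/
  mat : SL(2, ℤ)
  /-- the first lattice coordinate -/
  lam : ℤ
  /-- the second lattice coordinate -/
  mu : ℤ

namespace JacobiGroup

/-- The group law `(M, X) (M', X') = (M M', X M' + X')`, with row vectors `X = (lam, mu)`. -/
instance : Mul JacobiGroup where
  mul x y :=
    ⟨x.mat * y.mat,
      x.lam * y.mat 0 0 + x.mu * y.mat 1 0 + y.lam,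
      x.lam * y.mat 0 1 + x.mu * y.mat 1 1 + y.mu⟩

instance : One JacobiGroup where
  one := ⟨1, 0, 0⟩

/-- The inverse is `(M, X)⁻¹ = (M⁻¹, -X M⁻¹)`. -/
instance : Inv JacobiGroup where
  inv x :=
    ⟨x.mat⁻¹,
      -(x.lam * x.mat⁻¹ 0 0 + x.mu * x.mat⁻¹ 1 0),
      -(x.lam * x.mat⁻¹ 0 1 + x.mu * x.mat⁻¹ 1 1)⟩

@[simp] theorem mul_mat (x y : JacobiGroup) : (x * y).mat = x.mat * y.mat := rfl

@[simp] theorem mul_lam (x y : JacobiGroup) :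
    (x * y).lam = x.lam * y.mat 0 0 + x.mu * y.mat 1 0 + y.lam := rfl

@[simp] theorem mul_mu (x y : JacobiGroup) :
    (x * y).mu = x.lam * y.mat 0 1 + x.mu * y.mat 1 1 + y.mu := rfl

@[simp] theorem one_mat : (1 : JacobiGroup).mat = 1 := rfl
@[simp] theorem one_lam : (1 : JacobiGroup).lam = 0 := rfl
@[simp] theorem one_mu : (1 : JacobiGroup).mu = 0 := rfl

@[simp] theorem inv_mat (x : JacobiGroup) : x⁻¹.mat = x.mat⁻¹ := rfl

@[simp] theorem inv_lam (x : JacobiGroup) :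
    x⁻¹.lam = -(x.lam * x.mat⁻¹ 0 0 + x.mu * x.mat⁻¹ 1 0) := rfl

@[simp] theorem inv_mu (x : JacobiGroup) :
    x⁻¹.mu = -(x.lam * x.mat⁻¹ 0 1 + x.mu * x.mat⁻¹ 1 1) := rfl

instance : Group JacobiGroup :=
  Group.ofLeftAxioms
    (by
      intro x y z
      ext1
      · simp [mul_assoc]
      · simp [Matrix.mul_apply, Fin.sum_univ_two]
        ring
      · simp [Matrix.mul_apply, Fin.sum_univ_two]
        ring)
    (by
      intro x
      ext1 <;> simp)
    (by
      intro x
      ext1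
      · simp
      · have h := x.mat.det_coe
        rw [Matrix.det_fin_two] at h
        simp [Matrix.SpecialLinearGroup.SL2_inv_expl]
        linear_combination (-x.lam) * h
      · have h := x.mat.det_coe
        rw [Matrix.det_fin_two] at h
        simp [Matrix.SpecialLinearGroup.SL2_inv_expl]
        linear_combination (-x.mu) * h)

/-- The subgroup `{ ((1, b; 0, 1), (0, mu)) : b, mu ∈ ℤ }` of the Jacobi group. -/
def gammaInf : Subgroup JacobiGroup where
  carrier := {x | x.mat 0 0 = 1 ∧ x.mat 1 0 = 0 ∧ x.mat 1 1 = 1 ∧ x.lam = 0}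
  mul_mem' := by
    rintro x y ⟨h1, h2, h3, h4⟩ ⟨h5, h6, h7, h8⟩
    simp_all [Matrix.mul_apply, Fin.sum_univ_two]
  one_mem' := by simp
  inv_mem' := by
    rintro x ⟨h1, h2, h3, h4⟩
    simp_all [Matrix.SpecialLinearGroup.SL2_inv_expl]

end JacobiGroup

/-- `e(w) = exp(2 π i w)`. -/
def e (w : ℂ) : ℂ := Complex.exp (2 * Real.pi * Complex.I * w)

/-- The slash action of weight `k` and index `m` of the Jacobi group on functions `φ` on `ℍ × ℂ`:
`(φ|γ)(τ, z) = (cτ + d)^(-k) e(-c m (z + λτ + μ)² / (cτ + d) + m λ² τ + 2 m λ z)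
  φ((aτ + b) / (cτ + d), (z + λτ + μ) / (cτ + d))`. -/
def slash (k : ℤ) (m : ℕ) (φ : UpperHalfPlane → ℂ → ℂ) (γ : JacobiGroup)
    (τ : UpperHalfPlane) (z : ℂ) : ℂ :=
  ((γ.mat 1 0 : ℂ) * τ + γ.mat 1 1) ^ (-k) *
    e (-(γ.mat 1 0 : ℂ) * m * (z + γ.lam * τ + γ.mu) ^ 2 / ((γ.mat 1 0 : ℂ) * τ + γ.mat 1 1)
      + m * (γ.lam : ℂ) ^ 2 * τ + 2 * m * γ.lam * z) *
    φ (γ.mat • τ) ((z + γ.lam * τ + γ.mu) / ((γ.mat 1 0 : ℂ) * τ + γ.mat 1 1))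

/-- The function `(τ, z) ↦ e(n τ + r z)`. -/
def expo (n : ℕ) (r : ℤ) (τ : UpperHalfPlane) (z : ℂ) : ℂ := e (n * (τ : ℂ) + r * z)

theorem e_add_int (w : ℂ) (j : ℤ) : e (w + j) = e w := by
  unfold e
  rw [Complex.exp_eq_exp_iff_exists_int]
  exact ⟨j, by ring⟩

theorem e_add (v w : ℂ) : e (v + w) = e v * e w := by
  unfold e
  rw [← Complex.exp_add]
  ring_nf

theorem cocycle_ne_zero (M : SL(2, ℤ)) (τ : UpperHalfPlane) :
    (M 1 0 : ℂ) * τ + M 1 1 ≠ 0 := by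
  have h := UpperHalfPlane.denom_ne_zero (M : GL (Fin 2) ℝ) τ
  simpa [UpperHalfPlane.denom] using h

/-- Left translation by an element of `gammaInf` does not change the slashed exponential. -/
theorem slash_expo_gammaInf_mul (k : ℤ) (m n : ℕ) (r : ℤ) (h γ : JacobiGroup)
    (hh : h ∈ JacobiGroup.gammaInf) :
    slash k m (expo n r) (h * γ) = slash k m (expo n r) γ := by
  obtain ⟨h1, h2, h3, h4⟩ := hh
  funext τ z
  have hj := cocycle_ne_zero γ.mat τ
  have e10 : (h.mat * γ.mat) 1 0 = γ.mat 1 0 := by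
    simp [Matrix.mul_apply, Fin.sum_univ_two, h2, h3]
  have e11 : (h.mat * γ.mat) 1 1 = γ.mat 1 1 := by
    simp [Matrix.mul_apply, Fin.sum_univ_two, h2, h3]
  have e00 : (h.mat * γ.mat) 0 0 = γ.mat 0 0 + h.mat 0 1 * γ.mat 1 0 := by
    simp [Matrix.mul_apply, Fin.sum_univ_two, h1]
  have e01 : (h.mat * γ.mat) 0 1 = γ.mat 0 1 + h.mat 0 1 * γ.mat 1 1 := by
    simp [Matrix.mul_apply, Fin.sum_univ_two, h1]
  simp only [slash, expo, JacobiGroup.mul_mat, JacobiGroup.mul_lam, JacobiGroup.mul_mu,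
    e10, e11, h4, UpperHalfPlane.coe_specialLinearGroup_apply, e00, e01]
  rw [mul_assoc (_ ^ (-k)) (e _), mul_assoc (_ ^ (-k)) (e _), ← e_add, ← e_add]
  congr 1
  rw [← e_add_int _ (m * (2 * γ.mat 1 0 * h.mu * γ.mu + γ.mat 1 0 * h.mu ^ 2 * γ.mat 1 1)
    - n * h.mat 0 1 - r * h.mu)]
  congr 1
  push_cast
  simp only [algebraMap_int_eq, eq_intCast, Complex.ofReal_intCast]
  field_simp
  ring

/-- The `(n, r)`-th Jacobi Poincaré series of weight `k` and index `m`,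
`P(τ, z) = ∑ (e(n τ + r z)|γ)(τ, z)`, the sum over the cosets `gammaInf \ JacobiGroup`. -/
def poincareSeries (k : ℤ) (m n : ℕ) (r : ℤ) (τ : UpperHalfPlane) (z : ℂ) : ℂ :=
  ∑' q : Quotient (QuotientGroup.rightRel JacobiGroup.gammaInf),
    Quotient.liftOn q (fun γ => slash k m (expo n r) γ τ z) (by
      intro x y hxy
      have hxy' : y * x⁻¹ ∈ JacobiGroup.gammaInf := QuotientGroup.rightRel_apply.1 hxy
      have key := slash_expo_gammaInf_mul k m n r (y * x⁻¹) x hxy'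
      rw [inv_mul_cancel_right] at key
      show slash k m (expo n r) x τ z = slash k m (expo n r) y τ z
      rw [key])

/-- `M(x) = exp(B₁ log x / log log 2x)`. -/
def boundM (B₁ x : ℝ) : ℝ := Real.exp (B₁ * Real.log x / Real.log (Real.log (2 * x)))

/-- `A = (1/π) (2 / 6^(2/3) + 54 / 2^(5/6) + 16 / 2^(3/4))`. -/
def constA : ℝ :=
  1 / Real.pi * (2 / (6 : ℝ) ^ (2 / 3 : ℝ) + 54 / (2 : ℝ) ^ (5 / 6 : ℝ)
    + 16 / (2 : ℝ) ^ (3 / 4 : ℝ))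

/-- `λ = (2 √2 π^(5/3) A)^(3/2)`. -/
def constLambda : ℝ := (2 * √2 * Real.pi ^ (5 / 3 : ℝ) * constA) ^ (3 / 2 : ℝ)

end

end JacobiPoincare

/-!
Suppose that the Poincaré series vanishes identically. Restrict it to `τ = i v` and
`z = s τ + t` with `s = -r / (2 m)`, multiply it by `e (-r z)` and integrate over `0 ≤ t ≤ 1`, term by
term. The cosets with lower left entry `c = 0` contribute either `0` or `e (n τ) = exp (-2 π n v)`
(`integral_slash_of_lower_eq_zero`, the only place where the parity condition enters), and the
identity coset does contribute `exp (-2 π n v)`. It remains to show that the cosets with `c ≠ 0`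
contribute less than `exp (-2 π n v)` in absolute value.

Cosets are determined by `(c, d, l)` with `l = lam d - mu c`. Put `x = π D / m` and `j = |c τ + d|`. With
the above choice of `s`, the absolute value of the term of `(c, d, l)` is (`norm_slash_mul_I`)

`exp (-2 π n v) * j ^ (-k) * exp (x v / 2 * (1 - 1 / j²)) * exp (-2 π m v / j² * (l + s d - s - t c)²)`.

Summing the integrals over all `l` unfolds the Gaussian to its integral over the real line, which is
`j / √(2 m v)` (`hasSum_integral_gaussian`). If `j ^ (-k) * exp (x v / 2 * (1 - 1 / j²)) ≤ C * j ^ (-4)`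
whenever `j ≥ v`, then the remaining sum over `(c, d)` is at most `C / √(2 m v)` times
`∑ |c i v + d|⁻³ ≤ π² / 3 * (2 / v² + 1 / v³)` (`summable_inv_sqrt_pow_three_prod`), so the theorem
follows once this is less than one (`exists_poincareSeries_ne_zero`).

If `x ≥ e / 2`, then `M(x) ≥ 1`, so the hypothesis gives `2 x ^ 7 < m`. With the height `v = k / x` the
constant `C = e²` is admissible for all `k ≥ 4` because `w exp (1 - w) ≤ 1`, and the error is of order
`(x ^ 7 / m) ^ (1 / 2)`. If `1 < x < e / 2`, then `log log 2x < 0` and `M(x)` can be arbitrarily small, so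
only the bounds on `x` remain available. In this range `D ≥ 3`, because `-D` is a square
modulo `4`, hence `m x ≥ 3 π`, and the height `v = 5 / x` with `C = exp (5 / 2)` gives an error less than
one numerically.
-/

namespace JacobiPoincare

open MeasureTheory Real

/-! ### The slashed exponential in normalized coordinates -/

theorem norm_e (w : ℂ) : ‖e w‖ = rexp (-2 * π * w.im) := by
  rw [e, Complex.norm_exp]
  congr 1
  simp [Complex.mul_re, Complex.mul_im]

@[fun_prop]
theorem continuous_e : Continuous e := by
  unfold e
  fun_prop

/-- Write `z = s τ + t` and `(s', t') = (s + lam, t + mu) M⁻¹`. Up to a real summand, the exponent of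
`e (n τ + r z) | γ` times `e (-r z)` depends on `γ` only through `s'` and `γ • τ`. The key step is
`c (z + lam τ + mu) = (s + lam) (c τ + d) - s'`. -/
theorem exponent_eq (m n : ℕ) (r : ℤ) (γ : JacobiGroup) (τ : UpperHalfPlane) (s t : ℝ) :
    ∃ ρ : ℝ,
      -(γ.mat 1 0 : ℂ) * m * (s * τ + t + γ.lam * τ + γ.mu) ^ 2 /
          ((γ.mat 1 0 : ℂ) * τ + γ.mat 1 1)
        + m * (γ.lam : ℂ) ^ 2 * τ + 2 * m * γ.lam * (s * τ + t)
        + (n * ((γ.mat • τ : UpperHalfPlane) : ℂ)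
          + r * ((s * τ + t + γ.lam * τ + γ.mu) / ((γ.mat 1 0 : ℂ) * τ + γ.mat 1 1)))
        + -r * (s * τ + t)
      = ((m * ((s + γ.lam) * γ.mat 1 1 - (t + γ.mu) * γ.mat 1 0) ^ 2
          + r * ((s + γ.lam) * γ.mat 1 1 - (t + γ.mu) * γ.mat 1 0) + n : ℝ) : ℂ)
            * ((γ.mat • τ : UpperHalfPlane) : ℂ)
        - ((m * s ^ 2 + r * s : ℝ) : ℂ) * τ + ρ := by
  have hj := cocycle_ne_zero γ.mat τ
  have hτ : ((γ.mat • τ : UpperHalfPlane) : ℂ)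
      = ((γ.mat 0 0 : ℂ) * τ + γ.mat 0 1) / ((γ.mat 1 0 : ℂ) * τ + γ.mat 1 1) := by
    rw [UpperHalfPlane.coe_specialLinearGroup_apply]
    simp
  have hdet : (γ.mat 0 0 : ℂ) * γ.mat 1 1 - γ.mat 0 1 * γ.mat 1 0 = 1 := by
    have h := γ.mat.det_coe
    rw [Matrix.det_fin_two] at h
    exact_mod_cast h
  generalize ((γ.mat • τ : UpperHalfPlane) : ℂ) = τ' at *
  generalize hc : γ.mat 1 0 = c at *
  generalize hd : γ.mat 1 1 = d at *
  generalize ha : γ.mat 0 0 = a at *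
  generalize hb : γ.mat 0 1 = b at *
  set S : ℝ := s + γ.lam with hS
  set T : ℝ := t + γ.mu with hT
  set s' : ℝ := S * d - T * c with hs'
  set t' : ℝ := -S * b + T * a with ht'
  have hZ : (s * τ + t + γ.lam * τ + γ.mu : ℂ) = s' * (a * τ + b) + t' * (c * τ + d) := by
    simp only [hs', ht', hS, hT]
    push_cast
    linear_combination (-(s * τ + t + γ.lam * τ + γ.mu) : ℂ) * hdet
  have hcZ : (c * (s * τ + t + γ.lam * τ + γ.mu) : ℂ) = S * (c * τ + d) - s' := by
    simp only [hs', hS, hT]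
    push_cast
    ring
  have hz' : (s * τ + t + γ.lam * τ + γ.mu : ℂ) / (c * τ + d) = s' * τ' + t' := by
    rw [hZ, hτ, add_div, mul_div_cancel_right₀ _ hj, mul_div_assoc]
  have hZ2 : (s * τ + t + γ.lam * τ + γ.mu : ℂ) = S * τ + T := by
    simp only [hS, hT]
    push_cast
    ring
  have hq : -(c : ℂ) * m * (s * τ + t + γ.lam * τ + γ.mu) ^ 2 / (c * τ + d)
      = -m * S * (S * τ + T) + m * s' * (s' * τ' + t') := by
    rw [← hz', ← hZ2]
    calc -(c : ℂ) * m * (s * τ + t + γ.lam * τ + γ.mu) ^ 2 / (c * τ + d)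
        = -m * (c * (s * τ + t + γ.lam * τ + γ.mu))
            * ((s * τ + t + γ.lam * τ + γ.mu) / (c * τ + d)) := by ring
      _ = -m * S * ((c * τ + d) * ((s * τ + t + γ.lam * τ + γ.mu) / (c * τ + d)))
          + m * s' * ((s * τ + t + γ.lam * τ + γ.mu) / (c * τ + d)) := by
        rw [hcZ]
        ring
      _ = _ := by rw [mul_div_cancel₀ _ hj]
  refine ⟨-m * S * T + 2 * m * γ.lam * t + m * s' * t' + r * t' - r * t, ?_⟩
  rw [hq, hz']
  simp only [hS, hT]
  push_cast
  ring

/-- The absolute value of the term of `γ`; the expression multiplying `τ.im / ‖c τ + d‖ ^ 2` is the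
quadratic form `m s' ^ 2 + r s' + n` with `s' = (s + lam) d - (t + mu) c`. -/
theorem norm_slash_mul (k : ℤ) (m n : ℕ) (r : ℤ) (γ : JacobiGroup) (τ : UpperHalfPlane)
    (s t : ℝ) :
    ‖slash k m (expo n r) γ τ (s * τ + t) * e (-r * (s * τ + t))‖
      = ‖(γ.mat 1 0 : ℂ) * τ + γ.mat 1 1‖ ^ (-k) *
        rexp (-2 * π * ((m * ((s + γ.lam) * γ.mat 1 1 - (t + γ.mu) * γ.mat 1 0) ^ 2
          + r * ((s + γ.lam) * γ.mat 1 1 - (t + γ.mu) * γ.mat 1 0) + n)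
            * (τ.im / ‖(γ.mat 1 0 : ℂ) * τ + γ.mat 1 1‖ ^ 2) - (m * s ^ 2 + r * s) * τ.im)) := by
  obtain ⟨ρ, hρ⟩ := exponent_eq m n r γ τ s t
  rw [slash, expo, mul_assoc (_ ^ (-k)), mul_assoc (_ ^ (-k)), ← e_add, ← e_add, hρ, norm_mul,
    norm_zpow, norm_e]
  have him : (γ.mat • τ : UpperHalfPlane).im
      = τ.im / ‖(γ.mat 1 0 : ℂ) * τ + γ.mat 1 1‖ ^ 2 := by
    rw [ModularGroup.im_smul_eq_div_normSq]
    simp [UpperHalfPlane.denom, Complex.normSq_eq_norm_sq]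
  rw [← him]
  congr 2
  simp only [Complex.add_im, Complex.sub_im, Complex.im_ofReal_mul,
    Complex.ofReal_im, UpperHalfPlane.coe_im]
  ring

/-! ### Cosets -/

theorem poincareSeries_eq_tsum_out (k : ℤ) (m n : ℕ) (r : ℤ) (τ : UpperHalfPlane) (z : ℂ) :
    poincareSeries k m n r τ z
      = ∑' q : Quotient (QuotientGroup.rightRel JacobiGroup.gammaInf),
          slash k m (expo n r) q.out τ z := by
  unfold poincareSeries
  congr 1
  funext q
  conv_lhs => rw [← Quotient.out_eq q]
  rfl

/-- The triple `(c, d, lam * d - mu * c)` of an element of the Jacobi group, a complete invariant of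
its coset modulo `gammaInf`. -/
def invariants (γ : JacobiGroup) : (ℤ × ℤ) × ℤ :=
  ((γ.mat 1 0, γ.mat 1 1), γ.lam * γ.mat 1 1 - γ.mu * γ.mat 1 0)

theorem invariants_out_injective :
    Function.Injective fun q : Quotient (QuotientGroup.rightRel JacobiGroup.gammaInf) =>
      invariants q.out := by
  intro q₁ q₂ h
  simp only [invariants, Prod.mk.injEq] at h
  obtain ⟨⟨hc, hd⟩, hl⟩ := h
  rw [← Quotient.out_eq q₁, ← Quotient.out_eq q₂]
  refine Quotient.sound (QuotientGroup.rightRel_apply.2 ?_)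
  generalize q₁.out = x at *
  generalize q₂.out = y at *
  have hx := x.mat.det_coe
  have hy := y.mat.det_coe
  rw [Matrix.det_fin_two] at hx hy
  refine ⟨?_, ?_, ?_, ?_⟩
  · simp only [JacobiGroup.mul_mat, JacobiGroup.inv_mat, Matrix.SpecialLinearGroup.coe_mul,
      Matrix.SpecialLinearGroup.coe_inv, Matrix.adjugate_fin_two, Matrix.mul_apply,
      Fin.sum_univ_two, Matrix.of_apply, Matrix.cons_val]
    rw [hc, hd]
    linear_combination hy
  · simp only [JacobiGroup.mul_mat, JacobiGroup.inv_mat, Matrix.SpecialLinearGroup.coe_mul,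
      Matrix.SpecialLinearGroup.coe_inv, Matrix.adjugate_fin_two, Matrix.mul_apply,
      Fin.sum_univ_two, Matrix.of_apply, Matrix.cons_val]
    rw [hc, hd]
    ring
  · simp only [JacobiGroup.mul_mat, JacobiGroup.inv_mat, Matrix.SpecialLinearGroup.coe_mul,
      Matrix.SpecialLinearGroup.coe_inv, Matrix.adjugate_fin_two, Matrix.mul_apply,
      Fin.sum_univ_two, Matrix.of_apply, Matrix.cons_val]
    rw [← hc, ← hd]
    linear_combination hx
  · simp only [JacobiGroup.mul_lam, JacobiGroup.inv_mat, JacobiGroup.inv_lam,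
      Matrix.SpecialLinearGroup.coe_inv, Matrix.adjugate_fin_two, Matrix.of_apply,
      Matrix.cons_val]
    rw [hc, hd] at hl ⊢
    linear_combination -hl

/-! ### Unfolding and lattice sums -/

/-- Translating a function by the integers and averaging over a segment of integer length tiles the
real line. -/
theorem hasSum_integral_int_add_sub_mul {f : ℝ → ℝ} (hf : Integrable f) {c : ℤ} (hc : c ≠ 0)
    (α : ℝ) :
    HasSum (fun l : ℤ => ∫ t in (0 : ℝ)..1, f (l + α - t * c)) (∫ y, f y) := by
  have key : ∀ (N : ℕ), N ≠ 0 → ∀ β : ℝ,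
      HasSum (fun l : ℤ => ∫ t in (0 : ℝ)..1, f (l + β + t * N)) (∫ y, f y) := by
    intro N hN β
    have hN' : (N : ℝ) ≠ 0 := by exact_mod_cast hN
    have h1 := hasSum_sum (s := Finset.range N) fun j _ =>
      hf.hasSum_intervalIntegral (β + j)
    have h2 := h1.mul_left (N : ℝ)⁻¹
    rw [Finset.sum_const, Finset.card_range, nsmul_eq_mul, inv_mul_cancel_left₀ hN'] at h2
    refine h2.congr_fun ?_
    intro l
    have h3 := intervalIntegral.sum_integral_adjacent_intervals (f := f) (μ := volume)
      (a := fun j : ℕ => l + β + j) (n := N) fun j _ => hf.intervalIntegrable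
    have h4 : (∑ j ∈ Finset.range N, ∫ x in β + j + l..β + j + l + 1, f x)
        = ∫ x in (l : ℝ) + β + (0 : ℕ)..l + β + N, f x := by
      rw [← h3]
      refine Finset.sum_congr rfl fun j _ => ?_
      congr 1 <;> push_cast <;> ring
    rw [h4]
    have h5 := intervalIntegral.integral_comp_add_mul f hN' ((l : ℝ) + β) (a := 0) (b := 1)
    simp only [mul_comm (N : ℝ)] at h5
    rw [h5]
    simp
  rcases lt_or_gt_of_ne hc with h | h
  · obtain ⟨N, rfl⟩ := Int.exists_eq_neg_ofNat h.le
    have hN : N ≠ 0 := by omega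
    refine (key N hN α).congr_fun fun l => ?_
    refine intervalIntegral.integral_congr fun t _ => ?_
    simp
  · obtain ⟨N, rfl⟩ := Int.eq_ofNat_of_zero_le h.le
    have hN : N ≠ 0 := by omega
    refine (key N hN (α - N)).congr_fun fun l => ?_
    have h5 := intervalIntegral.integral_comp_sub_left (fun t => f (l + (α - N) + t * N)) (1 : ℝ)
      (a := 0) (b := 1)
    simp only [sub_self, sub_zero] at h5
    rw [← h5]
    refine intervalIntegral.integral_congr fun t _ => ?_
    simp only [Int.cast_natCast]
    congr 1
    ring

theorem summable_prod_and_tsum_le {α β : Type*} {f : α × β → ℝ} {g : α → ℝ} (hf : ∀ x, 0 ≤ f x)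
    (hs : ∀ a, Summable fun b => f (a, b)) (hle : ∀ a, ∑' b, f (a, b) ≤ g a) (hg : Summable g) :
    Summable f ∧ ∑' x, f x ≤ ∑' a, g a := by
  have h1 : Summable fun a => ∑' b, f (a, b) :=
    hg.of_nonneg_of_le (fun a => tsum_nonneg fun b => hf _) hle
  have h2 : Summable f := (summable_prod_of_nonneg hf).2 ⟨hs, h1⟩
  refine ⟨h2, ?_⟩
  rw [h2.tsum_prod' hs]
  exact h1.tsum_le_tsum hle hg

/-- The left-hand side is dominated by the increment of the primitive `y / (h² √(y² + h²))`. -/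
theorem inv_sqrt_pow_three_le_sub {h a : ℝ} (hh : 0 < h) (ha : 0 ≤ a) :
    ((√((a + 1) ^ 2 + h ^ 2)) ^ 3)⁻¹
      ≤ (a + 1) / (h ^ 2 * √((a + 1) ^ 2 + h ^ 2)) - a / (h ^ 2 * √(a ^ 2 + h ^ 2)) := by
  have hp2 : √(a ^ 2 + h ^ 2) ^ 2 = a ^ 2 + h ^ 2 := sq_sqrt (by positivity)
  have hq2 : √((a + 1) ^ 2 + h ^ 2) ^ 2 = (a + 1) ^ 2 + h ^ 2 := sq_sqrt (by positivity)
  have hp : 0 < √(a ^ 2 + h ^ 2) := by positivity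
  have hq : 0 < √((a + 1) ^ 2 + h ^ 2) := by positivity
  have hpq : √(a ^ 2 + h ^ 2) ≤ √((a + 1) ^ 2 + h ^ 2) := sqrt_le_sqrt (by nlinarith)
  generalize √(a ^ 2 + h ^ 2) = p at *
  generalize √((a + 1) ^ 2 + h ^ 2) = q at *
  have h0 : 0 < (a + 1) * p + a * q := by positivity
  have e1 : ((a + 1) * p - a * q) * ((a + 1) * p + a * q) = h ^ 2 * (2 * a + 1) := by
    linear_combination (a + 1) ^ 2 * hp2 - a ^ 2 * hq2
  have e2 : (a + 1) / (h ^ 2 * q) - a / (h ^ 2 * p)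
      = (2 * a + 1) / (p * q * ((a + 1) * p + a * q)) := by
    field_simp
    linear_combination e1
  rw [e2, inv_eq_one_div, div_le_div_iff₀ (by positivity) (by positivity)]
  have e3 : p * ((a + 1) * p + a * q) ≤ (2 * a + 1) * q ^ 2 := by
    have h1 : p * p ≤ q * q := by gcongr
    have h2 : p * q ≤ q * q := by gcongr
    nlinarith
  nlinarith

/-- The sum over a row of the lattice is the term `d = 0` plus at most twice `∫ (y² + h²)^(-3/2)` over
the half line. -/
theorem summable_inv_sqrt_pow_three {h : ℝ} (hh : 0 < h) :
    (Summable fun d : ℤ => ((√(h ^ 2 + (d : ℝ) ^ 2)) ^ 3)⁻¹) ∧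
      ∑' d : ℤ, ((√(h ^ 2 + (d : ℝ) ^ 2)) ^ 3)⁻¹ ≤ 2 / h ^ 2 + 1 / h ^ 3 := by
  set f : ℤ → ℝ := fun d => ((√(h ^ 2 + (d : ℝ) ^ 2)) ^ 3)⁻¹ with hf
  have hf0 : ∀ d, 0 ≤ f d := fun d => by positivity
  have hpart : ∀ N : ℕ, ∑ i ∈ Finset.range N, f (i + 1) ≤ 1 / h ^ 2 := by
    intro N
    have h1 : ∑ i ∈ Finset.range N, f (i + 1)
        ≤ ∑ i ∈ Finset.range N, (((i + 1 : ℕ) : ℝ) / (h ^ 2 * √(((i + 1 : ℕ) : ℝ) ^ 2 + h ^ 2))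
          - (i : ℝ) / (h ^ 2 * √((i : ℝ) ^ 2 + h ^ 2))) := by
      refine Finset.sum_le_sum fun i _ => ?_
      have := inv_sqrt_pow_three_le_sub hh (Nat.cast_nonneg' i (α := ℝ))
      simp only [hf]
      push_cast
      rwa [add_comm (h ^ 2)]
    rw [Finset.sum_range_sub (fun i : ℕ => (i : ℝ) / (h ^ 2 * √((i : ℝ) ^ 2 + h ^ 2)))] at h1
    refine h1.trans ?_
    have h2 : (N : ℝ) ≤ √((N : ℝ) ^ 2 + h ^ 2) := le_sqrt_of_sq_le (by nlinarith)
    have h3 : 0 < √((N : ℝ) ^ 2 + h ^ 2) := by positivity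
    rw [Nat.cast_zero, zero_div, sub_zero, div_le_div_iff₀ (by positivity) (by positivity)]
    nlinarith [sq_nonneg h]
  have hs1 : Summable fun i : ℕ => f (i + 1) :=
    summable_of_sum_range_le (fun _ => hf0 _) hpart
  have ht1 : ∑' i : ℕ, f (i + 1) ≤ 1 / h ^ 2 := Real.tsum_le_of_sum_range_le (fun _ => hf0 _) hpart
  have heven : ∀ d, f (-d) = f d := fun d => by simp [hf]
  have hz : HasSum f (∑' i : ℕ, f (i + 1) + f 0 + ∑' i : ℕ, f (i + 1)) := by
    refine HasSum.of_add_one_of_neg_add_one hs1.hasSum ?_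
    simpa only [heven] using hs1.hasSum
  refine ⟨hz.summable, ?_⟩
  rw [hz.tsum_eq]
  have h0 : f 0 = 1 / h ^ 3 := by simp [hf, sqrt_sq hh.le]
  rw [h0]
  have : 2 / h ^ 2 = 1 / h ^ 2 + 1 / h ^ 2 := by ring
  linarith

/-- The lattice sum `∑ |c i v + d|⁻³` over `c ≠ 0`. -/
theorem summable_inv_sqrt_pow_three_prod {v : ℝ} (hv : 0 < v) :
    (Summable fun p : ℤ × ℤ =>
      if p.1 = 0 then 0 else ((√((p.1 * v) ^ 2 + (p.2 : ℝ) ^ 2)) ^ 3)⁻¹) ∧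
    ∑' p : ℤ × ℤ, (if p.1 = 0 then 0 else ((√((p.1 * v) ^ 2 + (p.2 : ℝ) ^ 2)) ^ 3)⁻¹)
      ≤ π ^ 2 / 3 * (2 / v ^ 2 + 1 / v ^ 3) := by
  have hbasel : HasSum (fun c : ℤ => 1 / (c : ℝ) ^ 2) (π ^ 2 / 3) := by
    have h1 : HasSum (fun i : ℕ => 1 / (((i + 1 : ℕ) : ℝ)) ^ 2) (π ^ 2 / 6) :=
      by simpa using
        (hasSum_nat_add_iff' (f := fun n : ℕ => 1 / (n : ℝ) ^ 2) 1).2 hasSum_zeta_two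
    have h2 := HasSum.of_add_one_of_neg_add_one (f := fun c : ℤ => 1 / (c : ℝ) ^ 2)
      (by simpa using h1) (m' := π ^ 2 / 6) (by
        refine h1.congr_fun fun i => ?_
        push_cast
        ring)
    convert h2 using 1
    simp
    ring
  have hg := hbasel.mul_right (2 / v ^ 2 + 1 / v ^ 3)
  rw [← hg.tsum_eq]
  have hslice : ∀ c : ℤ, c ≠ 0 →
      (Summable fun d : ℤ => ((√((c * v) ^ 2 + (d : ℝ) ^ 2)) ^ 3)⁻¹) ∧
      ∑' d : ℤ, ((√((c * v) ^ 2 + (d : ℝ) ^ 2)) ^ 3)⁻¹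
        ≤ 1 / (c : ℝ) ^ 2 * (2 / v ^ 2 + 1 / v ^ 3) := by
    intro c hc
    have hc1 : (1 : ℝ) ≤ |(c : ℝ)| := by exact_mod_cast Int.one_le_abs hc
    have h := summable_inv_sqrt_pow_three (h := |(c : ℝ)| * v) (by positivity)
    have e1 : (|(c : ℝ)| * v) ^ 2 = (c * v) ^ 2 := by rw [mul_pow, sq_abs, mul_pow]
    rw [e1] at h
    refine ⟨h.1, h.2.trans ?_⟩
    have e2 : 1 / (|(c : ℝ)| * v) ^ 3 ≤ 1 / ((c : ℝ) ^ 2 * v ^ 3) := by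
      rw [← sq_abs (c : ℝ), mul_pow]
      have : |(c : ℝ)| ^ 2 ≤ |(c : ℝ)| ^ 3 := pow_le_pow_right₀ hc1 (by norm_num)
      gcongr
    calc _ ≤ 2 / (c * v) ^ 2 + 1 / ((c : ℝ) ^ 2 * v ^ 3) := by gcongr
      _ = _ := by
        field_simp
  refine summable_prod_and_tsum_le (fun x => by positivity) ?_ ?_ hg.summable
  · intro c
    by_cases hc : c = 0
    · simp [hc]
    · simpa [hc] using (hslice c hc).1
  · intro c
    by_cases hc : c = 0
    · simp [hc]
    · simpa [hc] using (hslice c hc).2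

/-! ### The cosets with vanishing lower left entry -/

theorem integral_e_int_mul (j : ℤ) :
    ∫ t in (0 : ℝ)..1, e (j * t) = if j = 0 then 1 else 0 := by
  split_ifs with hj
  · simp [hj, e]
  · have hc : (2 * π * Complex.I * j : ℂ) ≠ 0 := by
      simp [hj, pi_ne_zero]
    have h := integral_exp_mul_complex (a := 0) (b := 1) hc
    have h1 : Complex.exp (2 * π * Complex.I * j) = 1 := by
      rw [Complex.exp_eq_one_iff]
      exact ⟨j, by ring⟩
    simp only [Complex.ofReal_one, mul_one, Complex.ofReal_zero, mul_zero, Complex.exp_zero, h1,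
      sub_self, zero_div] at h
    rw [← h]
    refine intervalIntegral.integral_congr fun t _ => ?_
    simp only [e]
    ring_nf

/-- For an element with vanishing lower left entry the slashed exponential is a character in the real
part of `z`; its mean against `e (-r z)` vanishes unless that character is `e (r z)`. -/
theorem integral_slash_of_lower_eq_zero (k : ℤ) {m : ℕ} (hm : 0 < m) (n : ℕ) (r : ℤ)
    (hpar : (2 * (m : ℤ)) ∣ 2 * r → Even k) (γ : JacobiGroup) (hc : γ.mat 1 0 = 0)
    (τ : UpperHalfPlane) (s : ℝ) :
    (∫ t in (0 : ℝ)..1, slash k m (expo n r) γ τ (s * τ + t) * e (-r * (s * τ + t)))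
        = e (n * τ) ∨
      (∫ t in (0 : ℝ)..1, slash k m (expo n r) γ τ (s * τ + t) * e (-r * (s * τ + t))) = 0 := by
  have hdet := γ.mat.det_coe
  rw [Matrix.det_fin_two, hc, mul_zero, sub_zero] at hdet
  obtain ⟨ε, hε, ha, hd⟩ : ∃ ε : ℤ, ε * ε = 1 ∧ γ.mat 0 0 = ε ∧ γ.mat 1 1 = ε := by
    rcases Int.eq_one_or_neg_one_of_mul_eq_one' hdet with h | h
    · exact ⟨1, by norm_num, h.1, h.2⟩
    · exact ⟨-1, by norm_num, h.1, h.2⟩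
  have hεC : (ε : ℂ) * ε = 1 := by exact_mod_cast hε
  have hεinv : (ε : ℂ)⁻¹ = ε := inv_eq_of_mul_eq_one_left hεC
  set b := γ.mat 0 1 with hb
  -- The frequency in `t`, and the value at frequency zero up to an integral exponent.
  have hF : ∀ t : ℝ, slash k m (expo n r) γ τ (s * τ + t) * e (-r * (s * τ + t))
      = (ε : ℂ) ^ (-k) * e ((m * γ.lam ^ 2 + r * ε * γ.lam + n) * τ
          + (2 * m * γ.lam + r * ε - r : ℤ) * (s * τ)) *
          e ((2 * m * γ.lam + r * ε - r : ℤ) * t) := by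
    intro t
    have hτ : ((γ.mat • τ : UpperHalfPlane) : ℂ) = τ + ε * b := by
      rw [UpperHalfPlane.coe_specialLinearGroup_apply]
      simp only [ha, hc, hd, ← hb, algebraMap_int_eq, eq_intCast, Complex.ofReal_intCast,
        Int.cast_zero]
      rw [Complex.ofReal_zero, zero_mul, zero_add, div_eq_mul_inv, hεinv]
      linear_combination (τ : ℂ) * hεC
    rw [slash, expo, hτ, hc, hd, mul_assoc (_ ^ (-k)), mul_assoc (_ ^ (-k)),
      mul_assoc (_ ^ (-k)), ← e_add, ← e_add, ← e_add]
    simp only [Int.cast_zero, zero_mul, zero_add, neg_zero, zero_div]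
    congr 1
    rw [← e_add_int _ (-(n * ε * b) - r * ε * γ.mu), div_eq_mul_inv, hεinv]
    congr 1
    push_cast
    ring
  simp only [hF]
  rw [intervalIntegral.integral_const_mul, integral_e_int_mul]
  split_ifs with hfr
  · left
    rw [hfr]
    rcases Int.eq_one_or_neg_one_of_mul_eq_one hε with rfl | rfl
    · have hl : γ.lam = 0 := by
        have : 2 * (m : ℤ) * γ.lam = 0 := by linarith
        simpa [hm.ne'] using this
      simp [hl]
    · have hr : r = m * γ.lam := by linarith
      have hk : Even (-k) := (hpar ⟨γ.lam, by rw [hr]; ring⟩).neg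
      rw [Int.cast_neg, Int.cast_one, hk.neg_one_zpow, hr]
      simp only [Int.cast_zero, zero_mul, add_zero, one_mul, mul_one]
      congr 1
      push_cast
      ring
  · right
    simp

theorem integral_slash_one (k : ℤ) (m n : ℕ) (r : ℤ) (τ : UpperHalfPlane) (s : ℝ) :
    ∫ t in (0 : ℝ)..1, slash k m (expo n r) 1 τ (s * τ + t) * e (-r * (s * τ + t))
      = e (n * τ) := by
  have : ∀ t : ℝ, slash k m (expo n r) 1 τ (s * τ + t) * e (-r * (s * τ + t)) = e (n * τ) := by
    intro t
    simp only [slash, expo, JacobiGroup.one_mat, JacobiGroup.one_lam, JacobiGroup.one_mu]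
    simp [e, ← Complex.exp_add]
    ring_nf
  simp only [this, intervalIntegral.integral_const, sub_zero, one_smul]

theorem continuous_slash_mul (k : ℤ) (m n : ℕ) (r : ℤ) (γ : JacobiGroup) (τ : UpperHalfPlane)
    (s : ℝ) :
    Continuous fun t : ℝ => slash k m (expo n r) γ τ (s * τ + t) * e (-r * (s * τ + t)) := by
  simp only [slash, expo]
  fun_prop

/-! ### Nonvanishing from a bound on the height -/

/-- On the imaginary axis, with `s = -r / (2 m)`, completing the square in `m s' ^ 2 + r s' + n` splits
the absolute value of a term into the size `exp (-2 π n v)` of the identity term, a factor that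
depends only on `j = |c τ + d|`, and a Gaussian in `t`. -/
theorem norm_slash_mul_I (k : ℤ) {m : ℕ} (hm : 0 < m) (n : ℕ) (r : ℤ) (D : ℝ)
    (hD : D = 4 * m * n - r ^ 2) (γ : JacobiGroup) (τ : UpperHalfPlane)
    {v : ℝ} (hτ : (τ : ℂ) = v * Complex.I) (t : ℝ) :
    ‖slash k m (expo n r) γ τ (((-r / (2 * m) : ℝ) : ℂ) * τ + t)
        * e (-r * (((-r / (2 * m) : ℝ) : ℂ) * τ + t))‖
      = rexp (-2 * π * n * v) *
        (√(((invariants γ).1.1 * v) ^ 2 + ((invariants γ).1.2 : ℝ) ^ 2) ^ (-k) *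
          rexp (π * D * v / (2 * m) *
            (1 - 1 / √(((invariants γ).1.1 * v) ^ 2 + ((invariants γ).1.2 : ℝ) ^ 2) ^ 2))) *
        rexp (-(2 * π * m * v /
            √(((invariants γ).1.1 * v) ^ 2 + ((invariants γ).1.2 : ℝ) ^ 2) ^ 2) *
          ((invariants γ).2 + (-r / (2 * m) * (invariants γ).1.2 - -r / (2 * m))
            - t * (invariants γ).1.1) ^ 2) := by
  have hj := cocycle_ne_zero γ.mat τ
  have hm' : (m : ℝ) ≠ 0 := by positivity
  have him : τ.im = v := by
    rw [← UpperHalfPlane.coe_im, hτ]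
    simp
  have hnorm : ‖(γ.mat 1 0 : ℂ) * τ + γ.mat 1 1‖
      = √((γ.mat 1 0 * v) ^ 2 + (γ.mat 1 1 : ℝ) ^ 2) := by
    rw [Complex.norm_eq_sqrt_sq_add_sq, hτ]
    congr 1
    simp [Complex.mul_re, Complex.mul_im]
    ring
  have hj0 : √((γ.mat 1 0 * v) ^ 2 + (γ.mat 1 1 : ℝ) ^ 2) ≠ 0 := by
    rw [← hnorm]
    exact norm_ne_zero_iff.2 hj
  rw [norm_slash_mul, hnorm, him]
  simp only [invariants]
  rw [mul_left_comm (rexp (-2 * π * n * v)), mul_assoc (_ ^ (-k)), ← Real.exp_add, ← Real.exp_add]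
  congr 2
  generalize √((γ.mat 1 0 * v) ^ 2 + (γ.mat 1 1 : ℝ) ^ 2) = j at *
  rw [hD]
  push_cast
  field_simp
  ring

/-- The mean over `t` of the Gaussian factor, summed over the third invariant. -/
theorem hasSum_integral_gaussian {m v j : ℝ} (hm : 0 < m) (hv : 0 < v) (hj : 0 < j) {c : ℤ}
    (hc : c ≠ 0) (α : ℝ) :
    HasSum (fun l : ℤ => ∫ t in (0 : ℝ)..1,
      rexp (-(2 * π * m * v / j ^ 2) * (l + α - t * c) ^ 2)) (j / √(2 * m * v)) := by
  have hb : 0 < 2 * π * m * v / j ^ 2 := by positivity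
  have h := hasSum_integral_int_add_sub_mul (integrable_exp_neg_mul_sq hb) hc α
  rw [integral_gaussian] at h
  convert h using 1
  have : π / (2 * π * m * v / j ^ 2) = j ^ 2 / (2 * m * v) := by field_simp
  rw [this, sqrt_div (by positivity), sqrt_sq hj.le]

theorem summable_exp_neg_mul_int_add_sq {b : ℝ} (hb : 0 < b) (α : ℝ) :
    Summable fun l : ℤ => rexp (-b * (l + α) ^ 2) := by
  have h := (HurwitzZeta.hasSum_int_evenKernel α (t := b / π) (by positivity)).summable
  refine h.congr fun l => ?_
  congr 1
  field_simp

/-- Averages of the terms with `c ≠ 0`, indexed by the invariants `((c, d), l)`. -/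
theorem summable_integral_gaussian_prod {m v K : ℝ} (hm : 0 < m) (hv : 0 < v) (hK : 0 ≤ K)
    (s : ℝ) :
    let B : (ℤ × ℤ) × ℤ → ℝ := fun x => if x.1.1 = 0 then 0 else
      K * (√((x.1.1 * v) ^ 2 + (x.1.2 : ℝ) ^ 2) ^ 4)⁻¹ *
        ∫ t in (0 : ℝ)..1, rexp (-(2 * π * m * v /
            √((x.1.1 * v) ^ 2 + (x.1.2 : ℝ) ^ 2) ^ 2) *
          (x.2 + (s * x.1.2 - s) - t * x.1.1) ^ 2)
    (∀ x, 0 ≤ B x) ∧ Summable B ∧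
      ∑' x, B x ≤ K / √(2 * m * v) * (π ^ 2 / 3 * (2 / v ^ 2 + 1 / v ^ 3)) := by
  intro B
  have hB : ∀ x, 0 ≤ B x := fun x => by
    simp only [B]
    split_ifs
    · exact le_rfl
    · have : 0 ≤ ∫ t in (0 : ℝ)..1, rexp (-(2 * π * m * v /
            √((x.1.1 * v) ^ 2 + (x.1.2 : ℝ) ^ 2) ^ 2) *
          (x.2 + (s * x.1.2 - s) - t * x.1.1) ^ 2) :=
        intervalIntegral.integral_nonneg zero_le_one fun t _ => (Real.exp_pos _).le
      positivity
  have hlat := summable_inv_sqrt_pow_three_prod hv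
  have hslice : ∀ p : ℤ × ℤ, HasSum (fun l => B (p, l))
      (K / √(2 * m * v) * (if p.1 = 0 then 0 else ((√((p.1 * v) ^ 2 + (p.2 : ℝ) ^ 2)) ^ 3)⁻¹)) := by
    rintro ⟨c, d⟩
    by_cases hc : c = 0
    · simp [B, hc]
    · have hj : 0 < √((c * v) ^ 2 + (d : ℝ) ^ 2) := by positivity
      have h := (hasSum_integral_gaussian hm hv hj hc (s * d - s)).mul_left
        (K * (√((c * v) ^ 2 + (d : ℝ) ^ 2) ^ 4)⁻¹)
      simp only [B, hc, if_false]
      have e1 : K / √(2 * m * v) * (√((c * v) ^ 2 + (d : ℝ) ^ 2) ^ 3)⁻¹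
          = K * (√((c * v) ^ 2 + (d : ℝ) ^ 2) ^ 4)⁻¹
            * (√((c * v) ^ 2 + (d : ℝ) ^ 2) / √(2 * m * v)) := by
        generalize √((c * v) ^ 2 + (d : ℝ) ^ 2) = j at *
        field_simp
      rw [e1]
      exact h
  have h := summable_prod_and_tsum_le hB (fun p => (hslice p).summable)
    (fun p => (hslice p).tsum_eq.le) (hlat.1.mul_left _)
  refine ⟨hB, h.1, h.2.trans ?_⟩
  rw [tsum_mul_left]
  exact mul_le_mul_of_nonneg_left hlat.2 (by positivity)

/-- Majorants of the terms with `c = 0`, whose second invariant is `d = ±1`. -/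
theorem summable_gaussian_prod {b : ℝ} (hb : 0 < b) (E s : ℝ) :
    Summable fun x : (ℤ × ℤ) × ℤ => if x.1 ∈ ({(0, 1), (0, -1)} : Finset (ℤ × ℤ)) then
      E * rexp (-b * (x.2 + (s * x.1.2 - s)) ^ 2) else 0 := by
  have h : Summable fun x : (ℤ × ℤ) × ℤ =>
      if x.1 ∈ ({(0, 1), (0, -1)} : Finset (ℤ × ℤ)) then
        rexp (-b * (x.2 + (s * x.1.2 - s)) ^ 2) else 0 := by
    rw [summable_prod_of_nonneg fun x => by positivity]
    constructor
    · intro p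
      by_cases hp : p ∈ ({(0, 1), (0, -1)} : Finset (ℤ × ℤ))
      · simpa only [hp, if_true] using summable_exp_neg_mul_int_add_sq hb _
      · simpa only [hp, if_false] using summable_zero
    · refine summable_of_ne_finset_zero (s := {(0, 1), (0, -1)}) fun p hp => ?_
      simp only [hp, if_false, tsum_zero]
  refine (h.mul_left E).congr fun x => ?_
  simp only [mul_ite, mul_zero]

/-- If the terms with `c ≠ 0`, in the mean over `t` and relative to the identity term, sum to less than
one at height `v`, then the Poincaré series does not vanish identically. The hypothesis `hC` bounds
the factor depending on `j = |c τ + d|`, which is at least `v` when `c ≠ 0`. -/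
theorem exists_poincareSeries_ne_zero (k : ℤ) {m : ℕ} (hm : 0 < m) (n : ℕ) (r : ℤ)
    (hpar : (2 * (m : ℤ)) ∣ 2 * r → Even k) {D : ℝ} (hD : D = 4 * m * n - r ^ 2) {v C : ℝ}
    (hv : 0 < v)
    (hC : ∀ j, v ≤ j → j ^ (-k) * rexp (π * D * v / (2 * m) * (1 - 1 / j ^ 2)) ≤ C * (j ^ 4)⁻¹)
    (hlt : C / √(2 * m * v) * (π ^ 2 / 3 * (2 / v ^ 2 + 1 / v ^ 3)) < 1) :
    ∃ (τ : UpperHalfPlane) (z : ℂ), poincareSeries k m n r τ z ≠ 0 := by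
  classical
  by_contra! hzero
  have hmR : (0 : ℝ) < m := by exact_mod_cast hm
  have hC0 : 0 ≤ C := by
    have h1 := hC v le_rfl
    have h2 : 0 < C * (v ^ 4)⁻¹ := lt_of_lt_of_le (by positivity) h1
    exact (pos_of_mul_pos_left h2 (by positivity)).le
  let τ : UpperHalfPlane := ⟨v * Complex.I, by simpa using hv⟩
  have hτ : (τ : ℂ) = v * Complex.I := rfl
  set s : ℝ := -r / (2 * m) with hs
  set E : ℝ := rexp (-2 * π * n * v) with hE
  have hE0 : 0 < E := Real.exp_pos _
  have hen : e (n * τ) = (E : ℂ) := by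
    rw [hτ, e, hE, Complex.ofReal_exp]
    congr 1
    push_cast
    linear_combination (2 * π * n * v : ℂ) * Complex.I_mul_I
  let Q := Quotient (QuotientGroup.rightRel JacobiGroup.gammaInf)
  have hinj : Function.Injective fun q : Q => invariants q.out := invariants_out_injective
  have : Countable Q := hinj.countable
  let F : Q → ℝ → ℂ := fun q t =>
    slash k m (expo n r) q.out τ (s * τ + t) * e (-r * (s * τ + t))
  have hFc : ∀ q, Continuous (F q) := fun q => continuous_slash_mul k m n r q.out τ s
  let μ : Measure ℝ := volume.restrict (Set.Ioc 0 1)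
  have hFi : ∀ q, Integrable (F q) μ := fun q =>
    (intervalIntegrable_iff_integrableOn_Ioc_of_le zero_le_one).1 ((hFc q).intervalIntegrable 0 1)
  obtain ⟨hB0, hBs, hBt⟩ := summable_integral_gaussian_prod hmR hv
    (mul_nonneg hE0.le hC0) s
  set B : (ℤ × ℤ) × ℤ → ℝ := fun x => if x.1.1 = 0 then 0 else
      E * C * (√((x.1.1 * v) ^ 2 + (x.1.2 : ℝ) ^ 2) ^ 4)⁻¹ *
        ∫ t in (0 : ℝ)..1, rexp (-(2 * π * m * v /
            √((x.1.1 * v) ^ 2 + (x.1.2 : ℝ) ^ 2) ^ 2) *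
          (x.2 + (s * x.1.2 - s) - t * x.1.1) ^ 2) with hB
  -- The terms with `c ≠ 0`.
  have hbig : ∀ q : Q, (invariants q.out).1.1 ≠ 0 →
      ∫ t, ‖F q t‖ ∂μ ≤ B (invariants q.out) := by
    intro q hq
    simp only [hB, hq, if_false]
    rw [← intervalIntegral.integral_of_le zero_le_one, ← intervalIntegral.integral_const_mul]
    refine intervalIntegral.integral_mono_on zero_le_one
      ((hFc q).norm.intervalIntegrable 0 1)
      (Continuous.intervalIntegrable (by fun_prop) 0 1) fun t _ => ?_
    rw [norm_slash_mul_I k hm n r D hD q.out τ hτ t]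
    refine mul_le_mul_of_nonneg_right ?_ (Real.exp_pos _).le
    rw [mul_assoc E C]
    refine mul_le_mul_of_nonneg_left (hC _ ?_) hE0.le
    refine le_sqrt_of_sq_le ?_
    have h1 : (1 : ℝ) ≤ ((invariants q.out).1.1 : ℝ) ^ 2 := by
      exact_mod_cast (one_le_sq_iff_one_le_abs _).2 (Int.one_le_abs hq)
    rw [mul_pow]
    nlinarith [sq_nonneg ((invariants q.out).1.2 : ℝ), sq_nonneg v]
  -- The terms with `c = 0` have absolute value independent of `t`.
  have hsmall : ∀ q : Q, (invariants q.out).1.1 = 0 →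
      ∫ t, ‖F q t‖ ∂μ = (if (invariants q.out).1 ∈ ({(0, 1), (0, -1)} : Finset (ℤ × ℤ)) then
        E * rexp (-(2 * π * m * v) *
          ((invariants q.out).2 + (s * (invariants q.out).1.2 - s)) ^ 2) else 0) := by
    intro q hq
    have hd : (invariants q.out).1.2 = 1 ∨ (invariants q.out).1.2 = -1 := by
      have hdet := q.out.mat.det_coe
      simp only [invariants] at hq ⊢
      rw [Matrix.det_fin_two, hq, mul_zero, sub_zero] at hdet
      exact (Int.eq_one_or_neg_one_of_mul_eq_one' hdet).imp And.right And.right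
    have hd2 : ((invariants q.out).1.2 : ℝ) ^ 2 = 1 := by
      rcases hd with h | h <;> simp [h]
    have hmem : (invariants q.out).1 ∈ ({(0, 1), (0, -1)} : Finset (ℤ × ℤ)) := by
      simpa [Prod.ext_iff, hq] using hd
    rw [if_pos hmem, ← intervalIntegral.integral_of_le zero_le_one]
    have : ∀ t, ‖F q t‖ = E * rexp (-(2 * π * m * v) *
          ((invariants q.out).2 + (s * (invariants q.out).1.2 - s)) ^ 2) := by
      intro t
      rw [norm_slash_mul_I k hm n r D hD q.out τ hτ t, hq, hd2]
      simp [hE, hs]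
    simp only [this, intervalIntegral.integral_const, sub_zero, one_smul]
  have hFs : Summable fun q => ∫ t, ‖F q t‖ ∂μ := by
    have h1 := (hBs.comp_injective hinj).add
      ((summable_gaussian_prod (b := 2 * π * m * v) (by positivity) E s).comp_injective hinj)
    refine h1.of_nonneg_of_le (fun q => integral_nonneg fun t => norm_nonneg _) fun q => ?_
    simp only [Function.comp_apply]
    by_cases hq : (invariants q.out).1.1 = 0
    · rw [hsmall q hq]
      exact le_add_of_nonneg_left (hB0 _)
    · exact (hbig q hq).trans (le_add_of_nonneg_right (by positivity))
  have hsum := hasSum_integral_of_summable_integral_norm hFi hFs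
  have hint : ∫ t, ∑' q, F q t ∂μ = 0 := by
    have : ∀ t : ℝ, ∑' q, F q t = 0 := by
      intro t
      simp only [F]
      rw [tsum_mul_right, ← poincareSeries_eq_tsum_out, hzero, zero_mul]
    simp [this]
  rw [hint] at hsum
  have hre : HasSum (fun q => (∫ t, F q t ∂μ).re) 0 := by
    simpa using Complex.hasSum_re hsum
  -- The coset of the identity contributes `E`.
  let q₀ : Q := Quotient.mk _ 1
  have hmem : q₀.out ∈ JacobiGroup.gammaInf := by
    have h := Quotient.mk_out (s := QuotientGroup.rightRel JacobiGroup.gammaInf) (1 : JacobiGroup)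
    have h2 := QuotientGroup.rightRel_apply.1 h
    rw [one_mul] at h2
    exact inv_mem_iff.1 h2
  have hq₀ : ∫ t, F q₀ t ∂μ = E := by
    have hsl := slash_expo_gammaInf_mul k m n r q₀.out 1 hmem
    rw [mul_one] at hsl
    rw [← intervalIntegral.integral_of_le zero_le_one]
    simp only [F]
    rw [hsl, integral_slash_one, hen]
  have hc₀ : ∀ q : Q, (invariants q.out).1.1 = 0 → 0 ≤ (∫ t, F q t ∂μ).re := by
    intro q hq
    rw [← intervalIntegral.integral_of_le zero_le_one]
    rcases integral_slash_of_lower_eq_zero k hm n r hpar q.out hq τ s with h | h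
    · simp only [F]
      rw [h, hen, Complex.ofReal_re]
      exact hE0.le
    · simp only [F]
      rw [h, Complex.zero_re]
  -- A termwise lower bound for the real parts, whose sum is positive.
  have hlow : HasSum (fun q : Q => (if q = q₀ then E else 0) - B (invariants q.out))
      (E - ∑' q : Q, B (invariants q.out)) :=
    (hasSum_ite_eq q₀ E).sub (hBs.comp_injective hinj).hasSum
  have hle := hasSum_le (fun q => ?_) hlow hre
  · have h1 : ∑' q : Q, B (invariants q.out) ≤ ∑' x, B x :=
      tsum_comp_le_tsum_of_inj hBs hB0 hinj
    have h2 : E * C / √(2 * m * v) * (π ^ 2 / 3 * (2 / v ^ 2 + 1 / v ^ 3)) < E := by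
      calc _ = E * (C / √(2 * m * v) * (π ^ 2 / 3 * (2 / v ^ 2 + 1 / v ^ 3))) := by ring
        _ < E * 1 := mul_lt_mul_of_pos_left hlt hE0
        _ = E := mul_one E
    linarith
  · by_cases hq : (invariants q.out).1.1 = 0
    · have hBz : B (invariants q.out) = 0 := by simp [hB, hq]
      rw [hBz, sub_zero]
      split_ifs with h
      · rw [h, hq₀, Complex.ofReal_re]
      · exact hc₀ q hq
    · have hne : q ≠ q₀ := by
        rintro rfl
        exact hq hmem.2.1
      rw [if_neg hne, zero_sub]
      have h1 := Complex.abs_re_le_norm (∫ t, F q t ∂μ)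
      have h2 := norm_integral_le_integral_norm (μ := μ) (F q)
      have h3 := hbig q hq
      have h4 := neg_abs_le (∫ t, F q t ∂μ).re
      linarith

/-! ### Numerical estimates -/

/-- With height `5 / x` every automorphy factor with `c ≠ 0` has absolute value at least one. -/
theorem zpow_neg_mul_exp_le_of_le_one {k : ℤ} (hk : 3 < k) {j : ℝ} (hj : 1 ≤ j) :
    j ^ (-k) * rexp (5 / 2 * (1 - 1 / j ^ 2)) ≤ rexp (5 / 2) * (j ^ 4)⁻¹ := by
  have h0 : 0 < j := by linarith
  have h1 : j ^ (-k) ≤ (j ^ 4)⁻¹ := by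
    have := zpow_le_zpow_right₀ hj (show -k ≤ -4 by omega)
    rwa [zpow_neg j 4] at this
  have h2 : rexp (5 / 2 * (1 - 1 / j ^ 2)) ≤ rexp (5 / 2) := by
    have : 0 ≤ 1 / j ^ 2 := by positivity
    gcongr
    linarith
  rw [mul_comm (rexp _)]
  gcongr

/-- The function `w ↦ w exp (1 - w)` is at most one, so its power `k / 2` is largest for `k = 4`. -/
theorem zpow_neg_mul_exp_le {k : ℤ} (hk : 3 < k) {j : ℝ} (hj : 0 < j) :
    j ^ (-k) * rexp (k / 2 * (1 - 1 / j ^ 2)) ≤ rexp 2 * (j ^ 4)⁻¹ := by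
  obtain ⟨K, rfl⟩ := Int.eq_ofNat_of_zero_le (show 0 ≤ k by omega)
  have hK : 4 ≤ K := by omega
  set y : ℝ := j⁻¹ * rexp (1 / 2 * (1 - 1 / j ^ 2)) with hy
  have hy0 : 0 ≤ y := by positivity
  have hpow : ∀ N : ℕ, y ^ N = (j ^ N)⁻¹ * rexp (N / 2 * (1 - 1 / j ^ 2)) := by
    intro N
    rw [hy, mul_pow, ← Real.exp_nat_mul, inv_pow]
    congr 2
    ring
  have hy1 : y ≤ 1 := by
    have h2 : y ^ 2 ≤ 1 := by
      rw [hpow, Nat.cast_ofNat, div_self two_ne_zero, one_mul]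
      have h3 := Real.add_one_le_exp (1 / j ^ 2 - 1)
      have h4 : rexp (1 - 1 / j ^ 2) = (rexp (1 / j ^ 2 - 1))⁻¹ := by
        rw [← Real.exp_neg, neg_sub]
      rw [h4, ← mul_inv]
      refine inv_le_one_of_one_le₀ ?_
      rw [sub_add_cancel, div_le_iff₀ (by positivity)] at h3
      linarith
    exact (sq_le_one_iff₀ hy0).1 h2
  have h5 := pow_le_pow_of_le_one hy0 hy1 hK
  rw [hpow, hpow] at h5
  rw [zpow_neg, zpow_natCast, Int.cast_natCast]
  refine h5.trans ?_
  rw [mul_comm (rexp 2)]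
  have : 0 ≤ 1 / j ^ 2 := by positivity
  gcongr
  push_cast
  linarith

theorem exp_five_halves_lt : rexp (5 / 2) < 12.183 := by
  have h1 := Real.exp_one_lt_d9
  have h2 : rexp (5 / 2) ^ 2 = rexp 1 ^ 5 := by
    rw [← Real.exp_nat_mul, ← Real.exp_nat_mul]
    norm_num
  have h3 : rexp 1 ^ 5 < 2.7182818286 ^ 5 := by gcongr
  refine lt_of_pow_lt_pow_left₀ 2 (by norm_num) ?_
  rw [h2]
  refine h3.trans ?_
  norm_num

theorem constLambda_ge : 27 ≤ constLambda := by
  have hA : 27 / π ≤ constA := by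
    have h1 : (27 : ℝ) ≤ 54 / (2 : ℝ) ^ (5 / 6 : ℝ) := by
      have : (2 : ℝ) ^ (5 / 6 : ℝ) ≤ 2 ^ (1 : ℝ) :=
        rpow_le_rpow_of_exponent_le (by norm_num) (by norm_num)
      rw [rpow_one] at this
      rw [le_div_iff₀ (by positivity)]
      linarith
    have h2 : (0 : ℝ) ≤ 2 / (6 : ℝ) ^ (2 / 3 : ℝ) := by positivity
    have h3 : (0 : ℝ) ≤ 16 / (2 : ℝ) ^ (3 / 4 : ℝ) := by positivity
    rw [constA, div_eq_mul_one_div, mul_comm]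
    gcongr
    linarith
  have hpi : π ≤ π ^ (5 / 3 : ℝ) := by
    have := rpow_le_rpow_of_exponent_le (x := π) (by linarith [pi_gt_three])
      (show (1 : ℝ) ≤ 5 / 3 by norm_num)
    rwa [rpow_one] at this
  have h27 : (27 : ℝ) ≤ 2 * √2 * π ^ (5 / 3 : ℝ) * constA := by
    have h1 : (27 : ℝ) = π * (27 / π) := by field_simp
    have h2 : π * (27 / π) ≤ π ^ (5 / 3 : ℝ) * constA := by gcongr
    have h3 : (1 : ℝ) ≤ 2 * √2 := by
      have := one_le_sqrt.2 (one_le_two (α := ℝ))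
      linarith
    rw [mul_assoc]
    have h4 : 0 ≤ π ^ (5 / 3 : ℝ) * constA := by linarith
    nlinarith
  have h1 := rpow_le_rpow_of_exponent_le (x := 2 * √2 * π ^ (5 / 3 : ℝ) * constA)
    (by linarith) (show (1 : ℝ) ≤ 3 / 2 by norm_num)
  rw [rpow_one] at h1
  rw [constLambda]
  linarith

/-- At `x = e / 2` the inner logarithm of `boundM` vanishes, the quotient is zero by convention and
`boundM` equals one. -/
theorem one_le_boundM {B₁ x : ℝ} (hB₁ : 0 ≤ B₁) (hx : rexp 1 / 2 ≤ x) : 1 ≤ boundM B₁ x := by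
  have he := Real.exp_one_gt_two
  have h1 : 0 ≤ Real.log x := Real.log_nonneg (by linarith)
  have h2 : 1 ≤ Real.log (2 * x) := (Real.le_log_iff_exp_le (by linarith)).2 (by linarith)
  have h3 : 0 ≤ Real.log (Real.log (2 * x)) := Real.log_nonneg h2
  rw [boundM]
  exact Real.one_le_exp (by positivity)

/-- For `x < e / 2` the bound is numerical, the height being `5 / x`. -/
theorem error_lt_one_of_lt {m x : ℝ} (hx1 : 1 < x) (hx : x < rexp 1 / 2) (hmx : 3 * π ≤ m * x) :
    rexp (5 / 2) / √(2 * m * (5 / x)) *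
      (π ^ 2 / 3 * (2 / (5 / x) ^ 2 + 1 / (5 / x) ^ 3)) < 1 := by
  have hx2 : x < 1.35915 := by linarith [Real.exp_one_lt_d9]
  have hx0 : 0 < x := by linarith
  have hpi1 := pi_gt_d4
  have hpi2 := pi_lt_d4
  -- Here `2 m (5 / x) = 10 m x / x² ≥ 30 π / x²`.
  have hsq : (7.13 : ℝ) < √(2 * m * (5 / x)) := by
    refine lt_sqrt_of_sq_lt ?_
    have : 2 * m * (5 / x) = 10 * (m * x) / x ^ 2 := by field_simp; ring
    rw [this, lt_div_iff₀ (by positivity)]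
    have : x ^ 2 < 1.35915 ^ 2 := by gcongr
    nlinarith
  have h1 : 2 / (5 / x) ^ 2 + 1 / (5 / x) ^ 3 < 0.1679 := by
    have e1 : 2 / (5 / x) ^ 2 + 1 / (5 / x) ^ 3 = 2 * x ^ 2 / 25 + x ^ 3 / 125 := by
      field_simp
      ring
    have h2 : x ^ 2 < 1.35915 ^ 2 := by gcongr
    have h3 : x ^ 3 < 1.35915 ^ 3 := by gcongr
    rw [e1]
    norm_num at h2 h3 ⊢
    linarith
  have h2 : π ^ 2 / 3 < 3.291 := by
    have : π ^ 2 < 3.1416 ^ 2 := by gcongr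
    norm_num at this ⊢
    linarith
  have h3 := exp_five_halves_lt
  calc _ ≤ (12.183 / 7.13 * (3.291 * 0.1679) : ℝ) := by gcongr
    _ < 1 := by norm_num

/-- For larger `x` the height is `k / x`, and the error is of order `(x ^ 7 / m) ^ (1 / 2)`. -/
theorem error_lt_one_of_pow_seven_lt {k m x : ℝ} (hk : 4 ≤ k) (hx1 : 1 < x)
    (hmx : 2 * x ^ 7 < m) :
    rexp 2 / √(2 * m * (k / x)) * (π ^ 2 / 3 * (2 / (k / x) ^ 2 + 1 / (k / x) ^ 3)) < 1 := by
  have hx0 : 0 < x := by linarith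
  have hpi2 := pi_lt_d4
  have hm0 : 0 < m := lt_trans (by positivity) hmx
  have hsq : 4 * x ^ 3 ≤ √(2 * m * (k / x)) := by
    refine le_sqrt_of_sq_le ?_
    have h1 : 2 * (2 * x ^ 7) * (4 / x) ≤ 2 * m * (k / x) := by gcongr
    refine le_trans (le_of_eq ?_) h1
    field_simp
    ring
  have h1 : 2 / (k / x) ^ 2 + 1 / (k / x) ^ 3 ≤ 9 / 64 * x ^ 3 := by
    have h2 : 2 / (k / x) ^ 2 + 1 / (k / x) ^ 3 ≤ 2 / (4 / x) ^ 2 + 1 / (4 / x) ^ 3 := by gcongr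
    have e1 : 2 / (4 / x) ^ 2 + 1 / (4 / x) ^ 3 = x ^ 2 / 8 + x ^ 3 / 64 := by
      field_simp
      ring
    have h3 : x ^ 2 ≤ x ^ 3 := pow_le_pow_right₀ hx1.le (by norm_num)
    linarith
  have h2 : π ^ 2 / 3 < 3.3 := by
    have : π ^ 2 < 3.1416 ^ 2 := by gcongr
    norm_num at this ⊢
    linarith
  have h3 : rexp 2 < 7.4 := by
    have h4 : rexp 2 = rexp 1 ^ 2 := by
      rw [← Real.exp_nat_mul]
      norm_num
    have h5 : rexp 1 ^ 2 < 2.7182818286 ^ 2 := by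
      gcongr
      exact Real.exp_one_lt_d9
    rw [h4]
    refine h5.trans ?_
    norm_num
  calc _ ≤ 7.4 / (4 * x ^ 3) * (3.3 * (9 / 64 * x ^ 3)) := by gcongr
    _ = 7.4 / 4 * 3.3 * (9 / 64) := by field_simp
    _ < 1 := by norm_num

/-- The hypothesis on `D` forces `π D / m` to be at most of order `m ^ (1 / 7)`. -/
theorem two_mul_pow_seven_lt {m D L M s : ℝ} (hm : 1 ≤ m) (hD : 0 ≤ D) (hM : 1 ≤ M) (hs : 1 ≤ s)
    (hL : 27 ≤ L) (h : M * s * D < m ^ (8 / 7 : ℝ) / L) : 2 * (π * D / m) ^ 7 < m := by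
  have hm0 : 0 < m := by linarith
  have h1 : D ≤ M * s * D := le_mul_of_one_le_left hD (one_le_mul_of_one_le_of_one_le hM hs)
  have h2 : m ^ (8 / 7 : ℝ) / L ≤ m ^ (8 / 7 : ℝ) / 27 := by gcongr
  have h3 : D < m ^ (8 / 7 : ℝ) / 27 := by linarith
  have h4 : m ^ (8 / 7 : ℝ) = m * m ^ (1 / 7 : ℝ) := by
    rw [← rpow_one_add' hm0.le (by norm_num)]
    norm_num
  have h5 : (m ^ (1 / 7 : ℝ)) ^ 7 = m := by
    rw [← rpow_natCast, ← rpow_mul hm0.le]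
    norm_num
  have hpi := pi_lt_four
  have h6 : π * D / m ≤ 4 / 27 * m ^ (1 / 7 : ℝ) := by
    rw [div_le_iff₀ hm0]
    rw [h4] at h3
    nlinarith [pi_pos]
  calc 2 * (π * D / m) ^ 7 ≤ 2 * (4 / 27 * m ^ (1 / 7 : ℝ)) ^ 7 := by
        have := pi_pos
        gcongr
    _ = 2 * (4 / 27) ^ 7 * m := by rw [mul_pow, h5]; ring
    _ < m := by
        have : (2 * (4 / 27) ^ 7 : ℝ) < 1 := by norm_num
        nlinarith

end JacobiPoincare

theorem mainTheorem2 (k : ℤ) (hk : 3 < k) (m : ℕ) (hm : 0 < m) (n : ℕ) (r : ℤ)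
    (hpar : (2 * (m : ℤ)) ∣ 2 * r → Even k)
    (D : ℕ) (hD : (D : ℤ) = Matrix.det !![2 * (n : ℤ), r; r, 2 * (m : ℤ)])
    (hDm : (m : ℝ) / Real.pi < (D : ℝ))
    (B₁ : ℝ) (hB₁ : Real.log 2 < B₁)
    (hbound : JacobiPoincare.boundM B₁ (Real.pi * (D : ℝ) / (m : ℝ)) *
        (ArithmeticFunction.sigma 0 D : ℝ) * (D : ℝ)
      < (m : ℝ) ^ (8 / 7 : ℝ) / JacobiPoincare.constLambda) :
    ∃ (τ : UpperHalfPlane) (z : ℂ), JacobiPoincare.poincareSeries k m n r τ z ≠ 0 := by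
  have hmR : (1 : ℝ) ≤ m := by exact_mod_cast hm
  have hpi := Real.pi_pos
  have hDR : (0 : ℝ) < D := lt_of_le_of_lt (by positivity) hDm
  have hD0 : 0 < D := by exact_mod_cast hDR
  rw [Matrix.det_fin_two_of] at hD
  have hD' : (D : ℝ) = 4 * m * n - (r : ℝ) ^ 2 := by
    have : (D : ℤ) = 4 * m * n - r ^ 2 := by rw [hD]; ring
    exact_mod_cast this
  set x : ℝ := Real.pi * D / m with hx
  have hx1 : 1 < x := by
    rw [hx, lt_div_iff₀ (by linarith)]
    rw [div_lt_iff₀ hpi] at hDm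
    linarith
  have hx0 : 0 < x := by linarith
  have hxv : ∀ κ : ℝ, Real.pi * D * (κ / x) / (2 * m) = κ / 2 := by
    intro κ
    rw [hx]
    field_simp
  rcases lt_or_ge x (Real.exp 1 / 2) with hlt | hge
  · -- `D` is congruent to `0` or `3` modulo `4`.
    have hD3 : 3 ≤ D := by
      have h4 : (4 : ℤ) ∣ D + r * r := ⟨n * m, by rw [hD]; ring⟩
      rcases Int.even_or_odd' r with ⟨q, hq | hq⟩
      · have : (r * r : ℤ) = 4 * (q * q) := by rw [hq]; ring
        omega
      · have : (r * r : ℤ) = 4 * (q * q + q) + 1 := by rw [hq]; ring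
        omega
    have hmx : 3 * Real.pi ≤ m * x := by
      have h3 : (3 : ℝ) ≤ D := by exact_mod_cast hD3
      rw [hx, mul_div_cancel₀ _ (by linarith)]
      nlinarith
    refine JacobiPoincare.exists_poincareSeries_ne_zero k hm n r hpar hD' (v := 5 / x)
      (C := Real.exp (5 / 2)) (by positivity) (fun j hj => ?_)
      (JacobiPoincare.error_lt_one_of_lt hx1 hlt hmx)
    rw [hxv]
    refine JacobiPoincare.zpow_neg_mul_exp_le_of_le_one hk (le_trans ?_ hj)
    rw [le_div_iff₀ hx0]
    linarith [Real.exp_one_lt_d9]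
  · have hB : 0 ≤ B₁ := (Real.log_nonneg one_le_two).trans hB₁.le
    have hσ : (1 : ℝ) ≤ (ArithmeticFunction.sigma 0 D : ℝ) := by
      exact_mod_cast ArithmeticFunction.sigma_pos 0 D hD0.ne'
    have h7 := JacobiPoincare.two_mul_pow_seven_lt hmR hDR.le
      (JacobiPoincare.one_le_boundM hB hge) hσ JacobiPoincare.constLambda_ge hbound
    have hk4 : (4 : ℝ) ≤ k := by exact_mod_cast hk
    refine JacobiPoincare.exists_poincareSeries_ne_zero k hm n r hpar hD' (v := k / x)
      (C := Real.exp 2) (by positivity) (fun j hj => ?_)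
      (JacobiPoincare.error_lt_one_of_pow_seven_lt hk4 hx1 h7)
    rw [hxv]
    exact JacobiPoincare.zpow_neg_mul_exp_le hk (lt_of_lt_of_le (by positivity) hj)
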